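/- Let $\mathbf{k}$ be an algebraically closed field of characteristic $0$, and let $M$ be a linear space of skew-symmetric $n\times n$ matrices over $\mathbf{k}$ such that every nonzero matrix of $M$ has rank $2r$, with $\dim\mathbb{P}(M)=d$ (that is, $\dim_{\mathbf{k}}M=d+1$, $d\ge 0$). Identify skew-symmetric $m\times m$ matrices with $\Lambda^2\mathbf{k}^m$, let $\mathbb{G}(1,m-1)\subset\mathbb{P}(\Lambda^2\mathbf{k}^m)$ be the Plücker-embedded Grassmannian of lines of $\mathbb{P}^{m-1}$, and let $S_{s}\mathbb{G}(1,m-1)$ be the Zariski closure of the union of the linear spans of $s+1$ points of it. Then $\mathbb{P}(M)$ can be projected isomorphically into $S_{r-1}\mathbb{G}(1,2r+d-1)$ so that the rank stays constantly $2r$. Explicitly, with $m=2r+d$, there is a linear map $A:\mathbf{k}^n\to\mathbf{k}^m$ of maximal rank (surjective, i.e. inducing a linear projection $\mathbb{P}^{n-1}\dashrightarrow\mathbb{P}^{m-1}$, if $n\ge m$; injective, i.e. a linear embedding, if $n\le m$) such that the induced map $X\mapsto AXA^{T}$ is injective on $M$ (equivalently, $\mathbb{P}(M)$ does not meet the centre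 of the induced projection of $\mathbb{P}(\Lambda^2\mathbf{k}^n)$), the image of $\mathbb{P}(M)$ lies in $S_{r-1}\mathbb{G}(1,m-1)$, and every nonzero matrix of the image of $M$ has rank $2r$. In particular, every projective plane $\mathbb{P}(M)$ ($\dim_{\mathbf{k}} M=3$) of skew-symmetric matrices of constant rank $6$ can be projected isomorphically, in the same sense, into $S_2\mathbb{G}(1,7)$, i.e. to $8\times 8$ skew-symmetric matrices, so that the rank stays constantly $6$. -/

import Mathlib

open scoped LinearAlgebra.Projectivization

/-- The space `Λ² kⁿ`, realised as the skew-symmetric `n × n` matrices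
(used in characteristic zero). -/
def skewMatrices (k : Type*) [Field k] (n : ℕ) : Submodule k (Matrix (Fin n) (Fin n) k) where
  carrier := {X | X.transpose = -X}
  add_mem' := by
    intro a b ha hb
    simp only [Set.mem_ofPred_eq] at *
    rw [Matrix.transpose_add, ha, hb, neg_add]
  zero_mem' := by simp
  smul_mem' := by
    intro c X hX
    simp only [Set.mem_ofPred_eq] at *
    rw [Matrix.transpose_smul, hX, smul_neg]

/-- The bivector `v ∧ w`, as the skew-symmetric matrix `v wᵀ - w vᵀ`. -/
def wedge {k : Type*} [Field k] {n : ℕ} (v w : Fin n → k) : skewMatrices k n :=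
  ⟨Matrix.vecMulVec v w - Matrix.vecMulVec w v, by
    change (Matrix.vecMulVec v w - Matrix.vecMulVec w v).transpose = _
    rw [Matrix.transpose_sub, Matrix.transpose_vecMulVec, Matrix.transpose_vecMulVec, neg_sub]⟩

/-- The Grassmannian of lines `𝔾(1, n - 1)` of `ℙ(kⁿ)` in its Plücker embedding in `ℙ(Λ² kⁿ)`. -/
def grassmannianOfLines (k : Type*) [Field k] (n : ℕ) : Set (ℙ k (skewMatrices k n)) :=
  {p | ∃ v w : Fin n → k, LinearIndependent k ![v, w] ∧ p.submodule = k ∙ wedge v w}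

/-- The Zariski closure of a subset of `ℙ(Λ² kⁿ)`: the points at which every homogeneous
polynomial in the matrix entries vanishes that vanishes on the subset. -/
def zariskiClosure {k : Type*} [Field k] {n : ℕ} (T : Set (ℙ k (skewMatrices k n))) :
    Set (ℙ k (skewMatrices k n)) :=
  {p | ∀ (e : ℕ) (f : MvPolynomial (Fin n × Fin n) k), f.IsHomogeneous e →
    (∀ q ∈ T, MvPolynomial.eval (fun ij => q.rep.1 ij.1 ij.2) f = 0) →
    MvPolynomial.eval (fun ij => p.rep.1 ij.1 ij.2) f = 0}

/-- The secant variety `S_s 𝔾(1, n - 1)`: the Zariski closure of the union of the linear spans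
of `s + 1` points of the Grassmannian. -/
def secantVariety (k : Type*) [Field k] (n s : ℕ) : Set (ℙ k (skewMatrices k n)) :=
  zariskiClosure {p | ∃ q : Fin (s + 1) → ℙ k (skewMatrices k n),
    (∀ i, q i ∈ grassmannianOfLines k n) ∧ p.submodule ≤ ⨆ i, (q i).submodule}

/-- A linear space of skew-symmetric matrices all of whose nonzero elements have rank `ρ`. -/
def HasConstantRank {k : Type*} [Field k] {n : ℕ} (M : Submodule k (skewMatrices k n))
    (ρ : ℕ) : Prop :=
  ∀ X ∈ M, X ≠ 0 → X.1.rank = ρ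

/-- The map `Λ² A : Λ² kⁿ → Λ² kᵐ` induced by a linear map `A : kⁿ → kᵐ`; on skew-symmetric
matrices it is `X ↦ A X Aᵀ`. -/
def wedgeMap {k : Type*} [Field k] {m n : ℕ} (A : Matrix (Fin m) (Fin n) k) :
    skewMatrices k n →ₗ[k] skewMatrices k m where
  toFun X := ⟨A * X.1 * A.transpose, by
    have h : X.1.transpose = -X.1 := X.2
    change (A * X.1 * A.transpose).transpose = -(A * X.1 * A.transpose)
    rw [Matrix.transpose_mul, Matrix.transpose_mul, Matrix.transpose_transpose, h,
      Matrix.neg_mul, Matrix.mul_neg, Matrix.mul_assoc]⟩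
  map_add' X Y := by
    apply Subtype.ext
    simp [Matrix.mul_add, Matrix.add_mul]
  map_smul' c X := by
    apply Subtype.ext
    simp

/-- `Λ² A` sends `v ∧ w` to `A v ∧ A w`. -/
theorem wedgeMap_wedge {k : Type*} [Field k] {m n : ℕ} (A : Matrix (Fin m) (Fin n) k)
    (v w : Fin n → k) : wedgeMap A (wedge v w) = wedge (A.mulVec v) (A.mulVec w) := by
  apply Subtype.ext
  simp [wedgeMap, wedge, Matrix.mul_sub, Matrix.sub_mul, Matrix.mul_vecMulVec,
    Matrix.vecMulVec_mul, Matrix.vecMul_transpose]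

/-- `ℙ(M)` can be projected isomorphically into `S_{r-1} 𝔾(1, m - 1)` with constant rank `2r`.
There is a linear map `A : kⁿ → kᵐ`, surjective if `m ≤ n` (so that it gives a projection
`ℙ^{n-1} ⇢ ℙ^{m-1}`) and injective if `n ≤ m` (a linear embedding, when no projection is needed),
such that `Λ² A` is injective on `M`, that is, `ℙ(M)` is disjoint from the centre of the induced
projection `ℙ(Λ² kⁿ) ⇢ ℙ(Λ² kᵐ)`, which then maps `ℙ(M)` isomorphically onto the linear space
`ℙ(Λ² A (M))`; this image lies in `S_{r-1} 𝔾(1, m - 1)` and has constant rank `2r`. -/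
def ProjectsWithConstantRank {k : Type*} [Field k] {n : ℕ} (M : Submodule k (skewMatrices k n))
    (r m : ℕ) : Prop :=
  ∃ A : Matrix (Fin m) (Fin n) k,
    (m ≤ n → Function.Surjective A.mulVec) ∧
    (n ≤ m → Function.Injective A.mulVec) ∧
    ∃ hA : Function.Injective ((wedgeMap A).domRestrict M),
      (∀ p : ℙ k M,
        Projectivization.map ((wedgeMap A).domRestrict M) hA p ∈ secantVariety k m (r - 1)) ∧
      HasConstantRank (M.map (wedgeMap A)) (2 * r)

/-!
Write `m = 2r + d`. The matrix `A X Aᵀ` has the same rank as the skew-symmetric matrix `X` as soon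
as the kernel of `A` meets the column space of `X` trivially (`rank_conj_of_disjoint`), so `A` has
to be chosen with a kernel that avoids the column spaces of all nonzero `X ∈ M`.

The union of these column spaces is covered by finitely many images of polynomial maps from an
affine space of dimension `d + 2r`: up to scaling, one of the `d + 1` coordinates of `X` is `1`, and
some `2r` columns of `X` span its column space. If `n > 2r + d`, the `n` components of such a map
are algebraically dependent, so its image lies in a hypersurface, and finitely many hypersurfaces
do not cover `kⁿ` (`exists_forall_ne_eval`). Hence some vector `v` lies outside all the column
spaces (`exists_forall_notMem_range_mulVec`). Projecting from `v` lowers `n` by one and keeps the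
ranks; repeating this leads to `n = m`. When `n ≤ m`, any injective `A` will do.

That the image lies in the secant variety is the normal form of skew-symmetric matrices: one of
rank `2s` is a sum of `s` decomposable bivectors (`exists_eq_sum_wedge`). So every point of the image
already lies on the span of `r` points of the Grassmannian, with no need for the closure.
-/

open Matrix

/-! ### Images of polynomial maps from a space of smaller dimension -/

/-- The components of a polynomial map to an affine space of larger dimension satisfy a polynomial
relation. -/
theorem exists_ne_zero_aeval_eq_zero {k σ τ : Type*} [Field k] [Fintype σ] [Fintype τ]
    (h : Fintype.card σ < Fintype.card τ) (f : τ → MvPolynomial σ k) :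
    ∃ g : MvPolynomial τ k, g ≠ 0 ∧ MvPolynomial.aeval f g = 0 := by
  have hf : ¬ AlgebraicIndependent k f := by
    intro hf
    have h1 := hf.lift_cardinalMk_le_trdeg
    rw [MvPolynomial.trdeg_of_isDomain] at h1
    simp only [Cardinal.mk_fintype, Cardinal.lift_natCast, Nat.cast_le] at h1
    omega
  rw [algebraicIndependent_iff] at hf
  push Not at hf
  obtain ⟨g, hg, hg0⟩ := hf
  exact ⟨g, hg0, hg⟩

/-- Finitely many polynomial maps from affine spaces of smaller dimension do not cover an affine
space over an infinite field. -/
theorem exists_forall_ne_eval {k σ τ ι : Type*} [Field k] [Infinite k] [Fintype σ] [Fintype τ]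
    [Fintype ι] (h : Fintype.card σ < Fintype.card τ) (f : ι → τ → MvPolynomial σ k) :
    ∃ v : τ → k, ∀ i x, v ≠ fun t => MvPolynomial.eval x (f i t) := by
  choose g hg0 hg using fun i => exists_ne_zero_aeval_eq_zero h (f i)
  have hprod : ∏ i, g i ≠ 0 := Finset.prod_ne_zero_iff.2 fun i _ => hg0 i
  obtain ⟨v, hv⟩ : ∃ v, MvPolynomial.eval v (∏ i, g i) ≠ 0 := by
    by_contra! hv
    exact hprod (MvPolynomial.funext fun x => by simpa using hv x)
  refine ⟨v, fun i x hvx => hv ?_⟩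
  rw [map_prod]
  refine Finset.prod_eq_zero (Finset.mem_univ i) ?_
  have h1 := congrArg (MvPolynomial.eval x) (hg i)
  rw [MvPolynomial.aeval_def, MvPolynomial.algebraMap_eq, MvPolynomial.eval_eval₂,
    map_zero] at h1
  rw [hvx, ← h1, ← MvPolynomial.eval₂_id]
  congr 1
  ext a
  simp

/-! ### A vector outside all column spaces of a linear family -/

/-- The column space of a matrix of rank `ρ` is spanned by `ρ` of its columns. -/
theorem exists_eq_sum_columns {k : Type*} [Field k] {n p ρ : ℕ} (X : Matrix (Fin n) (Fin p) k)
    (hX : X.rank = ρ) (v : Fin n → k) (hv : v ∈ LinearMap.range X.mulVecLin) :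
    ∃ (I : Fin ρ → Fin p) (u : Fin ρ → k), ∀ i, v i = ∑ l, u l * X i (I l) := by
  rw [Matrix.rank_eq_finrank_span_cols] at hX
  subst hX
  obtain ⟨f, hf, hspan, -⟩ := Submodule.exists_fun_fin_finrank_span_eq k (Set.range X.col)
  choose I hI using hf
  rw [Matrix.range_mulVecLin, ← hspan, Submodule.mem_span_range_iff_exists_fun] at hv
  obtain ⟨u, rfl⟩ := hv
  refine ⟨I, u, fun i => ?_⟩
  simp [Finset.sum_apply, ← hI]

/-- The column spaces of the matrices of rank `ρ` in a linear family of projective dimension `d`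
do not cover `kⁿ` if `d + ρ < n`. -/
theorem exists_forall_notMem_range_mulVec {k : Type*} [Field k] [Infinite k] {n p d ρ : ℕ}
    (h : d + ρ < n) (B : Fin (d + 1) → Matrix (Fin n) (Fin p) k) :
    ∃ v : Fin n → k, ∀ c : Fin (d + 1) → k, c ≠ 0 → (∑ j, c j • B j).rank = ρ →
      v ∉ LinearMap.range (∑ j, c j • B j).mulVecLin := by
  -- The map with index `(j, I)` sends `(x, u)` to the combination with coefficients `u` of the
  -- columns `I` of the matrix with `j`-th coordinate `1` and other coordinates `x`.
  obtain ⟨v, hv⟩ := exists_forall_ne_eval (k := k) (σ := Fin d ⊕ Fin ρ) (τ := Fin n)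
    (ι := Fin (d + 1) × (Fin ρ → Fin p)) (by simpa using h)
    (fun jI i => ∑ l, MvPolynomial.X (Sum.inr l) * (MvPolynomial.C (B jI.1 i (jI.2 l)) +
      ∑ t, MvPolynomial.X (Sum.inl t) * MvPolynomial.C (B (jI.1.succAbove t) i (jI.2 l))))
  refine ⟨v, fun c hc hrank hmem => ?_⟩
  obtain ⟨j, hj⟩ := Function.ne_iff.1 hc
  obtain ⟨I, u, hu⟩ := exists_eq_sum_columns _ hrank v hmem
  -- Dividing the matrix by `c j` is compensated by multiplying `u` by it.
  refine hv (j, I) (Sum.elim (fun t => c (j.succAbove t) / c j) (fun l => u l * c j)) ?_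
  funext i
  have hj' : c j ≠ 0 := hj
  simp only [hu i, map_sum, map_mul, map_add, MvPolynomial.eval_X, MvPolynomial.eval_C,
    Sum.elim_inl, Sum.elim_inr]
  refine Finset.sum_congr rfl fun l _ => ?_
  rw [Matrix.sum_apply, Fin.sum_univ_succAbove _ j, mul_assoc]
  refine congrArg (u l * ·) ?_
  rw [mul_add, Finset.mul_sum]
  refine congrArg₂ (· + ·) rfl (Finset.sum_congr rfl fun t _ => ?_)
  simp only [Matrix.smul_apply, smul_eq_mul]
  field_simp

/-! ### Ranks under congruence -/

/-- Multiplication on the left by `A` keeps the rank if `ker A` meets the column space trivially. -/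
theorem rank_mul_eq_of_disjoint {k : Type*} [Field k] {m n p : ℕ} (A : Matrix (Fin m) (Fin n) k)
    (X : Matrix (Fin n) (Fin p) k)
    (h : ∀ w ∈ LinearMap.range X.mulVecLin, A *ᵥ w = 0 → w = 0) : (A * X).rank = X.rank := by
  have hinj : Function.Injective (A.mulVecLin.domRestrict (LinearMap.range X.mulVecLin)) := by
    rw [injective_iff_map_eq_zero]
    exact fun w hw => Subtype.ext (h w w.2 hw)
  rw [Matrix.rank, Matrix.mulVecLin_mul, LinearMap.range_comp, Matrix.rank,
    ← LinearMap.range_domRestrict, LinearMap.finrank_range_of_inj hinj]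

/-- The congruence `X ↦ A X Aᵀ` keeps the rank of a skew-symmetric matrix if `ker A` meets its
column space trivially. -/
theorem rank_conj_of_disjoint {k : Type*} [Field k] {m n : ℕ} (A : Matrix (Fin m) (Fin n) k)
    (X : skewMatrices k n)
    (h : ∀ w ∈ LinearMap.range X.1.mulVecLin, A *ᵥ w = 0 → w = 0) :
    (wedgeMap A X).1.rank = X.1.rank := by
  have hX : X.1ᵀ = -X.1 := X.2
  have hneg : (A * X.1).rank = (-(A * X.1)).rank := by
    have h1 : (-(A * X.1)).mulVecLin = -(A * X.1).mulVecLin :=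
      LinearMap.ext fun z => Matrix.neg_mulVec z _
    rw [Matrix.rank, Matrix.rank, h1, LinearMap.range_neg]
  -- Transposition turns the factor `Aᵀ` on the right into a factor `A` on the left.
  have h1 : (X.1 * Aᵀ).rank = X.1.rank := by
    rw [← Matrix.rank_transpose, Matrix.transpose_mul, Matrix.transpose_transpose, hX,
      Matrix.mul_neg, ← hneg, rank_mul_eq_of_disjoint A X.1 h]
  change (A * X.1 * Aᵀ).rank = _
  rw [Matrix.mul_assoc, rank_mul_eq_of_disjoint, h1]
  intro w hw
  rw [Matrix.mulVecLin_mul] at hw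
  exact h w (LinearMap.range_comp_le_range _ _ hw)

/-- The linear projection `kⁿ⁺¹ → kⁿ` from a nonzero vector. -/
theorem exists_surjective_mulVec_ker_eq_span {k : Type*} [Field k] {n : ℕ} (v : Fin (n + 1) → k)
    (hv : v ≠ 0) : ∃ B : Matrix (Fin n) (Fin (n + 1)) k,
      Function.Surjective B.mulVec ∧ ∀ w, B *ᵥ w = 0 → w ∈ k ∙ v := by
  have hrank : Module.finrank k ((Fin (n + 1) → k) ⧸ (k ∙ v)) = Module.finrank k (Fin n → k) := by
    have h1 := Submodule.finrank_quotient_add_finrank (k ∙ v)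
    rw [finrank_span_singleton hv] at h1
    simpa using h1
  let e := LinearEquiv.ofFinrankEq _ _ hrank
  let f : (Fin (n + 1) → k) →ₗ[k] (Fin n → k) := e.toLinearMap ∘ₗ (k ∙ v).mkQ
  have hf : ∀ w, LinearMap.toMatrix' f *ᵥ w = f w := fun w => LinearMap.toMatrix'_mulVec f w
  refine ⟨LinearMap.toMatrix' f, fun y => ?_, fun w hw => ?_⟩
  · obtain ⟨x, hx⟩ := (e.surjective.comp (Submodule.mkQ_surjective (k ∙ v))) y
    exact ⟨x, (hf x).trans hx⟩
  · rw [hf] at hw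
    have h2 : (k ∙ v).mkQ w = 0 := e.map_eq_zero_iff.1 hw
    simpa using h2

/-! ### Projecting a linear space of constant rank -/

theorem wedgeMap_mul {k : Type*} [Field k] {l m n : ℕ} (A : Matrix (Fin l) (Fin m) k)
    (B : Matrix (Fin m) (Fin n) k) (X : skewMatrices k n) :
    wedgeMap (A * B) X = wedgeMap A (wedgeMap B X) := by
  apply Subtype.ext
  simp [wedgeMap, Matrix.mul_assoc]

/-- If `n > ρ + d`, some vector lies in no column space of a nonzero matrix of `M`. -/
theorem HasConstantRank.exists_forall_notMem_range {k : Type*} [Field k] [Infinite k] {n d ρ : ℕ}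
    (h : d + ρ < n) {M : Submodule k (skewMatrices k n)} (hM : Module.finrank k M = d + 1)
    (hrank : HasConstantRank M ρ) :
    ∃ v : Fin n → k, ∀ X ∈ M, X ≠ 0 → v ∉ LinearMap.range X.1.mulVecLin := by
  have : Module.Free k M := Module.Free.of_divisionRing k M
  have : Module.Finite k M := Module.finite_of_finrank_eq_succ hM
  let b := Module.finBasisOfFinrankEq k M hM
  obtain ⟨v, hv⟩ := exists_forall_notMem_range_mulVec h (fun j => (b j).1.1)
  refine ⟨v, fun X hX hX0 => ?_⟩
  have hsum : ∑ j, b.repr ⟨X, hX⟩ j • (b j).1.1 = X.1 := by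
    have h1 := congrArg ((skewMatrices k n).subtype ∘ₗ M.subtype) (b.sum_repr ⟨X, hX⟩)
    rw [map_sum] at h1
    exact h1
  have h2 := hv (b.repr ⟨X, hX⟩) (fun h0 => hX0 ?_)
  · rw [hsum] at h2
    exact h2 (hrank X hX hX0)
  · have h3 : b.repr ⟨X, hX⟩ = 0 := DFunLike.coe_injective h0
    simpa using h3

theorem exists_injective_mulVec {k : Type*} [Field k] {m n : ℕ} (h : n ≤ m) :
    ∃ A : Matrix (Fin m) (Fin n) k, Function.Injective A.mulVec := by
  refine ⟨(1 : Matrix (Fin m) (Fin m) k).submatrix id (Fin.castLE h), fun x y hxy => ?_⟩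
  funext j
  have h1 := congrFun hxy (Fin.castLE h j)
  simpa [Matrix.mulVec, dotProduct, Matrix.one_apply] using h1

/-- Successive projections from points outside all column spaces, or an embedding if `n ≤ ρ + d`,
give a map of maximal rank `kⁿ → k^(ρ + d)` that keeps the ranks of all nonzero matrices of `M`. -/
theorem HasConstantRank.exists_rank_wedgeMap_eq {k : Type*} [Field k] [Infinite k] {d ρ : ℕ} :
    ∀ {n : ℕ} {M : Submodule k (skewMatrices k n)}, Module.finrank k M = d + 1 →
      HasConstantRank M ρ → 0 < ρ → ∃ A : Matrix (Fin (ρ + d)) (Fin n) k,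
        (ρ + d ≤ n → Function.Surjective A.mulVec) ∧ (n ≤ ρ + d → Function.Injective A.mulVec) ∧
        ∀ X ∈ M, X ≠ 0 → (wedgeMap A X).1.rank = ρ := by
  intro n
  induction n with
  | zero =>
    intro M hM hrank hρ
    have : Subsingleton M := inferInstance
    rw [Module.finrank_zero_of_subsingleton] at hM
    omega
  | succ n ih =>
    intro M hM hrank hρ
    rcases le_or_gt (n + 1) (ρ + d) with hn | hn
    · obtain ⟨A, hA⟩ := exists_injective_mulVec (k := k) hn
      refine ⟨A, fun h => ?_, fun _ => hA, fun X hX hX0 => ?_⟩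
      · have hcard : Module.finrank k (Fin (n + 1) → k) = Module.finrank k (Fin (ρ + d) → k) := by
          simpa using le_antisymm hn h
        exact (LinearMap.injective_iff_surjective_of_finrank_eq_finrank
          (f := A.mulVecLin) hcard).1 hA
      · rw [rank_conj_of_disjoint, hrank X hX hX0]
        intro w _ hw
        exact hA (by rw [hw, Matrix.mulVec_zero])
    · obtain ⟨v, hv⟩ := hrank.exists_forall_notMem_range (by omega) hM
      have : Nontrivial M := Module.nontrivial_of_finrank_pos (R := k) (by omega)
      have hv0 : v ≠ 0 := by
        rintro rfl
        obtain ⟨X, hX⟩ := exists_ne (0 : M)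
        exact hv X X.2 (by simpa using hX) (zero_mem _)
      obtain ⟨B, hB, hker⟩ := exists_surjective_mulVec_ker_eq_span v hv0
      have hBrank : ∀ X ∈ M, X ≠ 0 → (wedgeMap B X).1.rank = ρ := by
        intro X hX hX0
        rw [rank_conj_of_disjoint, hrank X hX hX0]
        intro w hw hBw
        obtain ⟨a, rfl⟩ := Submodule.mem_span_singleton.1 (hker w hBw)
        by_contra ha
        have ha0 : a ≠ 0 := by rintro rfl; simp at ha
        exact hv X hX hX0 ((Submodule.smul_mem_iff _ ha0).1 hw)
      have hB0 : ∀ X ∈ M, X ≠ 0 → wedgeMap B X ≠ 0 := by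
        intro X hX hX0 h0
        have h1 := hBrank X hX hX0
        rw [h0] at h1
        simp at h1
        omega
      have hinj : Function.Injective ((wedgeMap B).domRestrict M) := by
        rw [injective_iff_map_eq_zero]
        intro X hX
        by_contra hX0
        exact hB0 X X.2 (by simpa using hX0) hX
      have hM' : Module.finrank k (M.map (wedgeMap B)) = d + 1 := by
        rw [← hM, ← LinearMap.range_domRestrict, LinearMap.finrank_range_of_inj hinj]
      obtain ⟨A, hA1, -, hA⟩ := ih hM' (by
        rintro _ ⟨X, hX, rfl⟩ h0
        exact hBrank X hX (by rintro rfl; simp at h0)) hρ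
      refine ⟨A * B, fun _ => ?_, fun h => absurd h (by omega), fun X hX hX0 => ?_⟩
      · have h1 := (hA1 (by omega)).comp hB
        intro y
        obtain ⟨x, hx⟩ := h1 y
        exact ⟨x, by rw [← hx]; simp [Matrix.mulVec_mulVec]⟩
      · rw [wedgeMap_mul]
        exact hA _ (Submodule.mem_map_of_mem hX) (hB0 X hX hX0)

/-! ### Decomposition of skew-symmetric matrices -/

theorem wedge_mulVec {k : Type*} [Field k] {n : ℕ} (v w z : Fin n → k) :
    (wedge v w).1 *ᵥ z = (w ⬝ᵥ z) • v - (v ⬝ᵥ z) • w := by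
  change (vecMulVec v w - vecMulVec w v) *ᵥ z = _
  simp [Matrix.sub_mulVec, Matrix.vecMulVec_mulVec]

/-- Splitting a decomposable bivector off a nonzero skew-symmetric matrix: if `X a b ≠ 0`, the
columns `a` and `b` of `X` can be cleared, which lowers the rank by at least two. -/
theorem exists_wedge_rank_sub_add_two_le {k : Type*} [Field k] [CharZero k] {n : ℕ}
    (X : skewMatrices k n) (hX : X ≠ 0) :
    ∃ v w : Fin n → k, LinearIndependent k ![v, w] ∧ (X - wedge v w).1.rank + 2 ≤ X.1.rank := by
  have hskew : ∀ i j, X.1 i j = -X.1 j i := fun i j => congrFun (congrFun X.2 j) i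
  have hdiag : ∀ i, X.1 i i = 0 := fun i => self_eq_neg.1 (hskew i i)
  obtain ⟨a, b, hab⟩ : ∃ a b, X.1 a b ≠ 0 := by
    by_contra! h
    exact hX (Subtype.ext (Matrix.ext h))
  have hba : X.1 b a = -X.1 a b := hskew b a
  set c := X.1 a b with hc
  have hcol : ∀ j, X.1.col j ∈ LinearMap.range X.1.mulVecLin := fun j =>
    ⟨Pi.single j 1, by simp⟩
  refine ⟨c⁻¹ • X.1.col a, X.1.col b, ?_, ?_⟩
  · rw [LinearIndependent.pair_iff]
    intro s t hst
    have h1 := congrFun hst a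
    have h2 := congrFun hst b
    simp [hdiag, hba, ← hc, hab] at h1 h2
    exact ⟨h2, h1⟩
  · -- Rows `a` and `b` of the difference vanish, while the entries at `a` and `b` map the column
    -- space of `X` onto `k²`.
    let φ : (Fin n → k) →ₗ[k] k × k := (LinearMap.proj a).prod (LinearMap.proj b)
    let R := LinearMap.range X.1.mulVecLin
    have hsurj : LinearMap.range (φ.domRestrict R) = ⊤ := by
      rw [LinearMap.range_eq_top]
      rintro ⟨s, t⟩
      refine ⟨⟨(s / c) • X.1.col b - (t / c) • X.1.col a,
        R.sub_mem (R.smul_mem _ (hcol b)) (R.smul_mem _ (hcol a))⟩, ?_⟩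
      simp [φ, hdiag, hba, ← hc, hab]
    have hle : LinearMap.range (X - wedge (c⁻¹ • X.1.col a) (X.1.col b)).1.mulVecLin ≤
        (LinearMap.ker (φ.domRestrict R)).map R.subtype := by
      rintro _ ⟨z, rfl⟩
      have hz : (X - wedge (c⁻¹ • X.1.col a) (X.1.col b)).1 *ᵥ z =
          X.1 *ᵥ z - ((X.1.col b ⬝ᵥ z) • c⁻¹ • X.1.col a -
            ((c⁻¹ • X.1.col a) ⬝ᵥ z) • X.1.col b) := by
        rw [← wedge_mulVec, ← Matrix.sub_mulVec]
        rfl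
      have hrow : ∀ j, (X.1 *ᵥ z) j = -(X.1.col j ⬝ᵥ z) := by
        intro j
        simp only [Matrix.mulVec, dotProduct, ← Finset.sum_neg_distrib, Matrix.col_apply]
        exact Finset.sum_congr rfl fun i _ => by rw [hskew j i, neg_mul]
      have hmem : (X - wedge (c⁻¹ • X.1.col a) (X.1.col b)).1 *ᵥ z ∈ R := by
        rw [hz]
        exact R.sub_mem ⟨z, rfl⟩ (R.sub_mem (R.smul_mem _ (R.smul_mem _ (hcol a)))
          (R.smul_mem _ (hcol b)))
      refine ⟨⟨_, hmem⟩, ?_, rfl⟩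
      change φ ((X - wedge (c⁻¹ • X.1.col a) (X.1.col b)).1 *ᵥ z) = 0
      rw [hz]
      simp [φ, hrow, hdiag, hba, ← hc, hab]
      field_simp
      ring
    have h1 := LinearMap.finrank_range_add_finrank_ker (φ.domRestrict R)
    rw [hsurj, finrank_top, Module.finrank_prod, Module.finrank_self] at h1
    have h2 := (Submodule.finrank_mono hle).trans (Submodule.finrank_map_le _ _)
    change Module.finrank k _ + 2 ≤ Module.finrank k R
    omega

/-- A skew-symmetric matrix of rank at most `2s + 1` is a sum of at most `s` decomposable
bivectors. -/
theorem exists_eq_sum_wedge {k : Type*} [Field k] [CharZero k] {n : ℕ} :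
    ∀ (s : ℕ) (X : skewMatrices k n), X.1.rank ≤ 2 * s + 1 →
      ∃ (t : ℕ) (v w : Fin t → Fin n → k), t ≤ s ∧ (∀ i, LinearIndependent k ![v i, w i]) ∧
        X = ∑ i, wedge (v i) (w i) := by
  intro s
  induction s with
  | zero =>
    intro X hX
    by_cases h0 : X = 0
    · exact ⟨0, Fin.elim0, Fin.elim0, le_rfl, fun i => i.elim0, by simp [h0]⟩
    · obtain ⟨v, w, -, h⟩ := exists_wedge_rank_sub_add_two_le X h0
      omega
  | succ s ih =>
    intro X hX
    by_cases h0 : X = 0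
    · exact ⟨0, Fin.elim0, Fin.elim0, Nat.zero_le _, fun i => i.elim0, by simp [h0]⟩
    · obtain ⟨v, w, hvw, h⟩ := exists_wedge_rank_sub_add_two_le X h0
      obtain ⟨t, v', w', ht, hind, hsum⟩ := ih (X - wedge v w) (by omega)
      refine ⟨t + 1, Fin.cons v v', Fin.cons w w', by omega, ?_, ?_⟩
      · intro i
        refine Fin.cases ?_ (fun i => ?_) i
        · simpa using hvw
        · simpa using hind i
      · rw [Fin.sum_univ_succ]
        simp only [Fin.cons_zero, Fin.cons_succ]
        rw [← hsum]
        abel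

theorem wedge_ne_zero {k : Type*} [Field k] {n : ℕ} {v w : Fin n → k}
    (h : LinearIndependent k ![v, w]) : wedge v w ≠ 0 := by
  intro h0
  have hv : v ≠ 0 := h.ne_zero 0
  obtain ⟨j, hj⟩ := Function.ne_iff.1 hv
  have h1 := wedge_mulVec v w (Pi.single j 1)
  rw [h0] at h1
  simp only [ZeroMemClass.coe_zero, Matrix.zero_mulVec, dotProduct_single, mul_one] at h1
  rw [LinearIndependent.pair_iff] at h
  have h2 := h (w j) (-v j) (by rw [neg_smul, ← sub_eq_add_neg, ← h1])
  exact hj (by simpa using h2.2)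

/-- Points represented by matrices of rank at most `2s + 3` lie on the span of `s + 1` points of the
Grassmannian of lines. -/
theorem mem_secantVariety_of_rank_le {k : Type*} [Field k] [CharZero k] {n s : ℕ}
    (X : skewMatrices k n) (hX : X ≠ 0) (hrank : X.1.rank ≤ 2 * (s + 1) + 1) :
    Projectivization.mk k X hX ∈ secantVariety k n s := by
  intro e f _ hf
  refine hf _ ?_
  obtain ⟨t, v, w, ht, hind, hsum⟩ := exists_eq_sum_wedge (s + 1) X hrank
  have ht0 : 0 < t := by
    rcases Nat.eq_zero_or_pos t with rfl | h
    · exact absurd (by simpa using hsum) hX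
    · exact h
  -- If fewer than `s + 1` bivectors suffice, the first one is repeated.
  let g : Fin (s + 1) → Fin t := fun i => if h : i.1 < t then ⟨i.1, h⟩ else ⟨0, ht0⟩
  refine ⟨fun i => Projectivization.mk k (wedge (v (g i)) (w (g i))) (wedge_ne_zero (hind _)),
    fun i => ⟨v (g i), w (g i), hind _, Projectivization.submodule_mk _ _⟩, ?_⟩
  rw [Projectivization.submodule_mk, Submodule.span_singleton_le_iff_mem, hsum]
  refine Submodule.sum_mem _ fun i _ => ?_
  have hg : g (Fin.castLE ht i) = i := by simp [g]
  refine Submodule.mem_iSup_of_mem (Fin.castLE ht i) ?_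
  simp only [hg]
  rw [Projectivization.submodule_mk]
  exact Submodule.mem_span_singleton_self _

theorem HasConstantRank.projectsWithConstantRank {k : Type*} [Field k] [CharZero k] {n r d : ℕ}
    {M : Submodule k (skewMatrices k n)} (hM : Module.finrank k M = d + 1)
    (hrank : HasConstantRank M (2 * r)) : ProjectsWithConstantRank M r (2 * r + d) := by
  have : Nontrivial M := Module.nontrivial_of_finrank_pos (R := k) (by omega)
  have hr : 0 < r := by
    obtain ⟨X, hX⟩ := exists_ne (0 : M)
    have hX0 : (X : skewMatrices k n) ≠ 0 := by simpa using hX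
    refine Nat.pos_of_ne_zero fun h0 => hX0 (Subtype.ext ?_)
    have h1 := hrank X X.2 hX0
    rw [h0] at h1
    rw [mul_zero, Matrix.rank, Submodule.finrank_eq_zero, LinearMap.range_eq_bot] at h1
    exact Matrix.ext_of_mulVec_single fun j =>
      (LinearMap.congr_fun h1 (Pi.single j 1)).trans (Matrix.zero_mulVec _).symm
  obtain ⟨A, hsurj, hinj, hA⟩ := hrank.exists_rank_wedgeMap_eq hM (by omega)
  have hA0 : ∀ X ∈ M, X ≠ 0 → wedgeMap A X ≠ 0 := by
    intro X hX hX0 h0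
    have h1 := hA X hX hX0
    rw [h0] at h1
    simp at h1
    omega
  have hinjM : Function.Injective ((wedgeMap A).domRestrict M) := by
    rw [injective_iff_map_eq_zero]
    intro X hX
    by_contra hX0
    exact hA0 X X.2 (by simpa using hX0) hX
  refine ⟨A, hsurj, hinj, hinjM, fun p => ?_, ?_⟩
  · induction p with
    | h X hX =>
      rw [Projectivization.map_mk]
      refine mem_secantVariety_of_rank_le _ _ ?_
      have h1 := hA X X.2 (by simpa using hX)
      change (wedgeMap A X).1.rank ≤ _
      omega
  · rintro _ ⟨X, hX, rfl⟩ h0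
    exact hA X hX (by rintro rfl; simp at h0)

theorem mainTheorem7 (k : Type*) [Field k] [IsAlgClosed k] [CharZero k] :
    (∀ (n r d : ℕ) (M : Submodule k (skewMatrices k n)),
      Module.finrank k M = d + 1 → HasConstantRank M (2 * r) →
        ProjectsWithConstantRank M r (2 * r + d)) ∧
    (∀ (n : ℕ) (M : Submodule k (skewMatrices k n)),
      Module.finrank k M = 3 → HasConstantRank M 6 →
        ProjectsWithConstantRank M 3 8) :=
  ⟨fun _ _ _ _ hM hrank => hrank.projectsWithConstantRank hM,
    fun _ _ hM hrank => HasConstantRank.projectsWithConstantRank (r := 3) (d := 2) hM hrank⟩
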